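/- Let $\mathcal S$ be a finite state space, $t_{\min}<t_{\max}$, $\nu$ a probability distribution on $\mathcal S$ and $Q(s,s')\ge 0$ ($s\ne s'$) transition intensities. Put $Q(s)=\sum_{s'\ne s}Q(s,s')$ and $Q_{\max}=\max_s Q(s)$. A trajectory is a right-continuous piecewise constant function $X:[t_{\min},t_{\max}]\to\mathcal S$ with finitely many jumps, all in $(t_{\min},t_{\max})$; $J(X)$ denotes the finite set of its (true) jump times, and the space of trajectories carries the $\sigma$-algebra generated by the evaluations $X\mapsto X(t)$. Let $t_{\min}\le t^{\rm obs}_1<\dots<t^{\rm obs}_k\le t_{\max}$ be observation times, let $L_j:\mathcal S\to[0,\infty)$ be the likelihood functions of the fixed evidence $Y=(Y_1,\dots,Y_k)$, and put $L(Y|X)=\prod_{j=1}^k L_j(X(t^{\rm obs}_j))$. Assume that $L(Y|X)>0$ with positive probability when $X$ is the homogeneous Markov jump process with initial distribution $\nu$ and intensities $Q$, that $Q$ is irreducible, and that $\lambda>Q_{\max}$. Let $P(s,s')=Q(s,s')/\lambda$ for $s\ne s'$ and $P(s,s)=1-Q(s)/\lambda$. One step of the Rao–Teh algorithm from a trajectory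 $X$ to a trajectory $X'$, whose law is denoted by $A(X,\cdot)$, is the following. (V) Draw a Poisson process $V$ on $[t_{\min},t_{\max}]$ with intensity $\lambda-Q(X(t))$ and put $T'=J(X)\cup V=\{T'_1<\dots<T'_n\}$. (S) Draw a skeleton $S'=(S'_0,\dots,S'_n)$ with probability proportional to $\nu(S'_0)\prod_{i=1}^n P(S'_{i-1},S'_i)\prod_{j=1}^k L_j(S'_{i_j})$, where $i_j=\max\{i:T'_i\le t^{\rm obs}_j\}$ and $T'_0=t_{\min}$, and let $X'(t)=S'_i$ for $T'_i\le t<T'_{i+1}$, where $T'_{n+1}=\infty$. (If all these weights vanish, so that stage (S) is undefined, put $X'=X$.) Then for every $h\in\{0,1,2,\dots\}$ the set $\{X:|J(X)|\le h\}$ is 1-small for $A$: there are $\beta>0$ and a probability measure $\nu^*$ on the space of trajectories such that $$A(X,B)\ \ge\ \beta\,\nu^*(B)$$ for every trajectory $X$ with $|J(X)|\le h$ and every measurable set $B$ of trajectories. -/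

import Mathlib

open MeasureTheory Set Filter Topology

noncomputable section

namespace RaoTeh

/-! ### Trajectories -/

section Trajectories

variable {S : Type*} {a b : ℝ}

/-- The inclusion of the open time interval into the closed one. -/
def toIcc (t : Ioo a b) : Icc a b := ⟨t.1, Ioo_subset_Icc_self t.2⟩

/-- Given potential jump times `T₁ < ⋯ < T_N` (a finite set `T`), the index
`max {i : T_i ≤ t} = #{i : T_i ≤ t}` of the interval that contains the time `t` (with `T₀ = a`). -/
def index (T : Finset (Ioo a b)) (t : Icc a b) : Fin (T.card + 1) :=
  ⟨(T.filter fun τ : Ioo a b => (τ : ℝ) ≤ t).card, Nat.lt_succ_of_le (Finset.card_filter_le _ _)⟩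

/-- The right continuous step function with potential jump times `T` and skeleton `s`:
it equals `s i` on `[T_i, T_{i+1})`. -/
def stepFun (T : Finset (Ioo a b)) (s : Fin (T.card + 1) → S) (t : Icc a b) : S :=
  s (index T t)

variable (S a b) in
/-- Trajectories on `[a, b]`: right continuous, piecewise constant functions with values in `S` and
with finitely many jumps, all of them in `(a, b)`. -/
def Trajectory : Type _ :=
  {X : Icc a b → S // ∃ (T : Finset (Ioo a b)) (s : Fin (T.card + 1) → S), X = stepFun T s}

/-- The cylinder σ-algebra, generated by the evaluations `X ↦ X(t)`. -/
instance : MeasurableSpace (Trajectory S a b) :=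
  ⨆ t : Icc a b, MeasurableSpace.comap (fun X => X.1 t) ⊤

/-- The trajectory represented by potential jump times `T` and a skeleton `s`. -/
def path (T : Finset (Ioo a b)) (s : Fin (T.card + 1) → S) : Trajectory S a b :=
  ⟨stepFun T s, T, s, rfl⟩

/-- The times of true jumps of `X`: the discontinuity points of `X`, that is, the points at which
`X` is not locally constant. -/
def jumpSet (X : Trajectory S a b) : Set (Ioo a b) :=
  {t | ¬ ∀ᶠ u in 𝓝 (toIcc t), X.1 u = X.1 (toIcc t)}

theorem finite_jumpSet (X : Trajectory S a b) : (jumpSet X).Finite := by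
  obtain ⟨X, T, s, rfl⟩ := X
  refine T.finite_toSet.subset fun t ht => ?_
  by_contra hT
  apply ht
  have key : ∀ τ ∈ T, ∀ᶠ u : Icc a b in 𝓝 (toIcc t), ((τ : ℝ) ≤ u ↔ (τ : ℝ) ≤ t) := by
    intro τ hτ
    have hne : (τ : ℝ) ≠ t := fun h => hT (by
      have h' : τ = t := Subtype.ext h
      simpa [h'] using hτ)
    have hc : Tendsto (fun u : Icc a b => (u : ℝ)) (𝓝 (toIcc t)) (𝓝 (t : ℝ)) :=
      continuous_subtype_val.continuousAt
    rcases lt_or_gt_of_ne hne with h | h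
    · filter_upwards [hc.eventually (lt_mem_nhds h)] with u hu
      exact ⟨fun _ => h.le, fun _ => hu.le⟩
    · filter_upwards [hc.eventually (gt_mem_nhds h)] with u hu
      exact ⟨fun h1 => absurd hu (not_lt.2 h1), fun h1 => absurd h (not_lt.2 h1)⟩
  have := (Finset.eventually_all T).2 key
  filter_upwards [this] with u hu
  show s (index T u) = s (index T (toIcc t))
  congr 1
  apply Fin.ext
  exact congrArg Finset.card (Finset.filter_congr hu)

/-- `J(X)`, the finite set of true jump times of `X`. -/
def jumps (X : Trajectory S a b) : Finset (Ioo a b) := (finite_jumpSet X).toFinset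

end Trajectories

/-! ### Poisson processes -/

/-- The law of a Poisson process with finite intensity measure `μ`. A configuration is given by its
number `n` of points and an enumeration of them; the number of points is Poisson distributed with
mean `m = μ(E)`, and given `n` the points are independent with law `μ / m`, so that the
part with `n` points is `e^{-m} / n! • μ^{⊗ n}`. -/
def poissonProcess {E : Type*} [MeasurableSpace E] (μ : Measure E) :
    Measure (Σ n : ℕ, Fin n → E) :=
  Measure.sum fun n : ℕ =>
    ENNReal.ofReal (Real.exp (-(μ univ).toReal) / (Nat.factorial n : ℝ)) •
      (Measure.pi fun _ : Fin n => μ).map (fun v => (⟨n, v⟩ : Σ n : ℕ, Fin n → E))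

/-- The set of points of a configuration. -/
def points {E : Type*} [DecidableEq E] (v : Σ n : ℕ, Fin n → E) : Finset E :=
  Finset.univ.image v.2

/-! ### Hidden Markov jump processes -/

/-- The data of a hidden Markov jump process on the finite state space `S`, on the time interval
`[tmin, tmax]`, with initial distribution `init` and transition intensities `Q s s'`, `s ≠ s'`
(the values `Q s s` play no role), observed at the times `tobs 0 < ⋯ < tobs (k - 1)`.
The evidence `Y` is fixed and `L j s = L_j(Y_j | s)` is the likelihood of the `j`-th observation
given that the state at time `tobs j` is `s`. -/
structure HiddenMJP (S : Type*) [Fintype S] where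
  tmin : ℝ
  tmax : ℝ
  tmin_lt_tmax : tmin < tmax
  init : S → ℝ
  init_nonneg : ∀ s, 0 ≤ init s
  init_sum : ∑ s, init s = 1
  Q : S → S → ℝ
  Q_nonneg : ∀ s s', s ≠ s' → 0 ≤ Q s s'
  k : ℕ
  tobs : Fin k → Icc tmin tmax
  tobs_strictMono : StrictMono tobs
  L : Fin k → S → ℝ
  L_nonneg : ∀ j s, 0 ≤ L j s

namespace HiddenMJP

variable {S : Type*} [Fintype S] [DecidableEq S] (M : HiddenMJP S)

/-- The intensity `Q(s) = ∑_{s' ≠ s} Q(s, s')` of leaving the state `s`. -/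
def exitRate (s : S) : ℝ := ∑ s' ∈ Finset.univ.erase s, M.Q s s'

/-- The maximal intensity of leaving a state. -/
def qmax : ℝ := ⨆ s, M.exitRate s

/-- Irreducibility of the intensities: every state leads to every other one through
transitions of positive intensity. -/
def Irreducible : Prop :=
  ∀ s s' : S, Relation.ReflTransGen (fun x y => x ≠ y ∧ 0 < M.Q x y) s s'

/-- The generator of the Markov jump process: the intensities off the diagonal, and rows that
sum to zero. -/
def generator : Matrix S S ℝ :=
  Matrix.of fun s s' => if s = s' then -M.exitRate s else M.Q s s'

/-- The finite dimensional distributions `ℙ(X(t₁) = s₁, …, X(t_n) = s_n)`, for times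
`tmin ≤ t₁ ≤ ⋯ ≤ t_n`, of the homogeneous Markov process with the given initial distribution at
`tmin` and with transition matrices `exp (t • generator)`. -/
def finDimProb {n : ℕ} (t : Fin n → ℝ) (s : Fin n → S) : ℝ :=
  ∑ s₀, M.init s₀ * ∏ i : Fin n,
    (NormedSpace.exp ((t i - (Fin.cons M.tmin t : Fin (n + 1) → ℝ) i.castSucc) • M.generator) :
      Matrix S S ℝ) ((Fin.cons s₀ s : Fin (n + 1) → S) i.castSucc) (s i)

/-- The hidden process is possible: `L(Y | X) > 0` has positive probability if `X` is the Markov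
jump process (recall that `L(Y | X) = ∏ j, L_j(X(tobs j))`). -/
def Possible : Prop :=
  0 < ∑ s : Fin M.k → S,
    if 0 < ∏ j, M.L j (s j) then M.finDimProb (fun j => (M.tobs j : ℝ)) s else 0

/-! ### The algorithm -/

/-- The transition matrix of the uniformized chain. -/
def P (lam : ℝ) (s s' : S) : ℝ :=
  if s = s' then 1 - M.exitRate s / lam else M.Q s s' / lam

/-- The likelihood `L(Y | X)` of the fixed evidence. -/
def likelihood (X : Trajectory S M.tmin M.tmax) : ℝ := ∏ j, M.L j (X.1 (M.tobs j))

/-- The unnormalized conditional probability of the skeleton `s` given the potential jump times `T`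
and the evidence: the product of the uniformized chain's probability of `s` and the likelihood. -/
def weight (lam : ℝ) (T : Finset (Ioo M.tmin M.tmax)) (s : Fin (T.card + 1) → S) : ℝ :=
  (M.init (s 0) * ∏ i : Fin T.card, M.P lam (s i.castSucc) (s i.succ)) * M.likelihood (path T s)

/-- The normalizing constant of `p(S | T, Y)`. -/
def totalWeight (lam : ℝ) (T : Finset (Ioo M.tmin M.tmax)) : ℝ :=
  ∑ s : Fin (T.card + 1) → S, M.weight lam T s

/-- Stage (S): the law of the trajectory with potential jump times `T` and a skeleton drawn from
`p(S | T, Y)`. Where this conditional distribution is undefined, because no skeleton is possible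
(this can only happen to impossible current trajectories `X`), the current `X` is kept. -/
def resample (lam : ℝ) (X : Trajectory S M.tmin M.tmax) (T : Finset (Ioo M.tmin M.tmax)) :
    Measure (Trajectory S M.tmin M.tmax) :=
  if M.totalWeight lam T = 0 then Measure.dirac X
  else ∑ s : Fin (T.card + 1) → S,
    ENNReal.ofReal (M.weight lam T s / M.totalWeight lam T) • Measure.dirac (path T s)

/-- The intensity measure `(λ - Q(X(t))) dt` of the virtual jumps. -/
def virtualIntensity (lam : ℝ) (X : Trajectory S M.tmin M.tmax) :
    Measure (Ioo M.tmin M.tmax) :=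
  ((volume : Measure ℝ).comap Subtype.val).withDensity fun t => ENNReal.ofReal (lam - M.exitRate (X.1 (toIcc t)))

/-- The transition kernel `A(X, ·)` of the algorithm: draw the virtual jumps `V` from the Poisson
process with intensity `λ - Q(X(t))`, put `T' = J(X) ∪ V`, and resample the skeleton. -/
def kernel (lam : ℝ) (X : Trajectory S M.tmin M.tmax) : Measure (Trajectory S M.tmin M.tmax) :=
  (poissonProcess (M.virtualIntensity lam X)).bind fun v =>
    M.resample lam X (jumps X ∪ points v)

end HiddenMJP

/-- `C` is a 1-small set for the transition kernel `A`: for some `β > 0` and some probability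
measure `νs`, the minorization `A(x, ·) ≥ β νs(·)` holds for all `x ∈ C`. -/
def IsOneSmall {E : Type*} [MeasurableSpace E] (A : E → Measure E) (C : Set E) : Prop :=
  ∃ (β : ℝ) (νs : Measure E), 0 < β ∧ IsProbabilityMeasure νs ∧
    ∀ x ∈ C, ∀ B : Set E, MeasurableSet B → ENNReal.ofReal β * νs B ≤ A x B

/-! ### The transition law is well defined -/

open Classical in
theorem measurable_count {a b : ℝ} (J : Finset (Ioo a b)) (n : ℕ) (p : Ioo a b → Prop) [DecidablePred p]
    (hp : MeasurableSet {x | p x}) :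
    Measurable fun v : Fin n → Ioo a b => ((J ∪ Finset.univ.image v).filter p).card := by
  have key : ∀ v : Fin n → Ioo a b, ((J ∪ Finset.univ.image v).filter p).card =
      (J.filter p).card + ∑ i : Fin n,
        if (p (v i) ∧ v i ∉ J ∧ ∀ j < i, v j ≠ v i) then 1 else 0 := by
    intro v
    rw [← Finset.card_filter]
    have : ((J ∪ Finset.univ.image v).filter p) = J.filter p ∪
        ((Finset.univ.filter fun i => p (v i) ∧ v i ∉ J ∧ ∀ j < i, v j ≠ v i).image v) := by
      ext x
      simp only [Finset.mem_filter, Finset.mem_union, Finset.mem_image, Finset.mem_univ, true_and]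
      constructor
      · rintro ⟨hx, hpx⟩
        by_cases hJ : x ∈ J
        · exact Or.inl ⟨hJ, hpx⟩
        · right
          have hx' : ∃ i, v i = x := by tauto
          obtain ⟨i, hi, hmin⟩ := WellFounded.has_min (wellFounded_lt (α := Fin n)) {i | v i = x} hx'
          have hi' : v i = x := hi
          refine ⟨i, ⟨hi' ▸ hpx, hi' ▸ hJ, fun j hj h => hmin j (h.trans hi') hj⟩, hi'⟩
      · rintro (h | ⟨i, ⟨h1, h2, h3⟩, rfl⟩)
        · exact ⟨Or.inl h.1, h.2⟩
        · exact ⟨Or.inr ⟨i, rfl⟩, h1⟩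
    rw [this, Finset.card_union_of_disjoint, Finset.card_image_of_injOn]
    · intro i hi j hj hij
      simp only [Finset.coe_filter, Finset.mem_univ, true_and, mem_ofPred_eq] at hi hj
      rcases lt_trichotomy i j with h | h | h
      · exact absurd hij (hj.2.2 i h)
      · exact h
      · exact absurd hij.symm (hi.2.2 j h)
    · rw [Finset.disjoint_left]
      intro x hx hx'
      simp only [Finset.mem_filter, Finset.mem_image, Finset.mem_univ, true_and] at hx hx'
      obtain ⟨i, h, rfl⟩ := hx'
      exact h.2.1 hx.1
  simp_rw [key]
  refine Measurable.const_add (Finset.measurable_sum _ fun i _ => Measurable.ite ?_ measurable_const measurable_const) _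
  refine MeasurableSet.inter (measurable_pi_apply i hp) (MeasurableSet.inter ?_ ?_)
  · exact (measurable_pi_apply (X := fun _ : Fin n => Ioo a b) i) (J.finite_toSet.measurableSet.compl)
  · have : {v : Fin n → Ioo a b | ∀ j < i, v j ≠ v i} = ⋂ j, ⋂ (_ : j < i), {v | v j = v i}ᶜ := by
      ext; simp
    change MeasurableSet {v : Fin n → Ioo a b | ∀ j < i, v j ≠ v i}
    rw [this]
    exact MeasurableSet.iInter fun j => MeasurableSet.iInter fun _ =>
      (measurableSet_eq_fun (measurable_pi_apply j) (measurable_pi_apply i)).compl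

theorem measurable_traj {α S : Type*} [MeasurableSpace α] {a b : ℝ} {f : α → Trajectory S a b}
    (hf : ∀ t, @Measurable _ _ _ ⊤ fun x => (f x).1 t) : Measurable f := by
  apply Measurable.of_comap_le
  unfold instMeasurableSpaceTrajectory
  rw [MeasurableSpace.comap_iSup]
  refine iSup_le fun t => ?_
  rw [MeasurableSpace.comap_comp]
  exact @Measurable.comap_le _ _ _ ⊤ _ (hf t)

theorem measurable_eval {S : Type*} {a b : ℝ} (t : Icc a b) :
    @Measurable _ _ _ ⊤ fun X : Trajectory S a b => X.1 t := by
  have : MeasurableSpace.comap (fun X : Trajectory S a b => X.1 t) ⊤ ≤ instMeasurableSpaceTrajectory :=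
    le_iSup (fun t : Icc a b => MeasurableSpace.comap (fun X : Trajectory S a b => X.1 t) ⊤) t
  exact @measurable_iff_comap_le _ _ _ ⊤ _ |>.2 this

namespace HiddenMJP

variable {S : Type*} [Fintype S] [DecidableEq S] (M : HiddenMJP S)

/-- Auxiliary: `path T s` for a skeleton `s` of prescribed length, if `T` has `m` points. -/
def pathOfCard (X : Trajectory S M.tmin M.tmax) (m : ℕ) (s : Fin (m+1) → S) (T : Finset (Ioo M.tmin M.tmax)) :
    Trajectory S M.tmin M.tmax :=
  if h : T.card = m then path T (fun i => s (Fin.cast (by rw [h]) i)) else X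

theorem measurable_pathOfCard (X : Trajectory S M.tmin M.tmax) (m : ℕ) (s : Fin (m+1) → S)
   (J : Finset (Ioo M.tmin M.tmax)) (n : ℕ) : Measurable fun v : Fin n → Ioo M.tmin M.tmax =>
     M.pathOfCard X m s (J ∪ Finset.univ.image v) := by
  refine measurable_traj fun t => ?_
  let _ : MeasurableSpace S := ⊤
  have : ∀ T, (M.pathOfCard X m s T).1 t = if (T.filter fun _ => True).card = m then
      s (Fin.ofNat (m+1) (T.filter fun τ : Ioo M.tmin M.tmax => (τ : ℝ) ≤ t).card) else X.1 t := by
    intro T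
    unfold pathOfCard
    rw [Finset.filter_true]
    split_ifs with h
    · subst h
      simp only [path, stepFun, index]
      congr 1
      apply Fin.ext
      simp only [Fin.ofNat, Fin.val_cast]
      rw [Nat.mod_eq_of_lt (Nat.lt_succ_of_le (Finset.card_filter_le _ _))]
    · rfl
  simp_rw [this]
  refine Measurable.ite ?_ ?_ measurable_const
  · exact measurable_count J n (fun _ => True) (by simp) (measurableSet_singleton m)
  · exact (measurable_of_countable (fun k : ℕ => s (Fin.ofNat (m+1) k))).comp
      (measurable_count J n _ (measurableSet_le measurable_subtype_coe measurable_const))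

theorem measurable_likelihood : Measurable M.likelihood := by
  unfold likelihood
  refine Finset.measurable_prod _ fun j _ => ?_
  let _ : MeasurableSpace S := ⊤
  exact (measurable_of_finite (M.L j)).comp (measurable_eval _)

/-- The law drawn from in stage (S) depends measurably on the configuration of virtual jumps, so
that the mixture in the definition of `kernel` is meaningful. -/
theorem measurable_resample (lam : ℝ) (X : Trajectory S M.tmin M.tmax) (J : Finset (Ioo M.tmin M.tmax)) :
    Measurable fun v : Σ n : ℕ, Fin n → Ioo M.tmin M.tmax => M.resample lam X (J ∪ points v) := by
  let w (m : ℕ) (s : Fin (m+1) → S) (T) : ℝ :=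
    (M.init (s 0) * ∏ i : Fin m, M.P lam (s i.castSucc) (s i.succ)) * M.likelihood (M.pathOfCard X m s T)
  let F (m : ℕ) (T : Finset (Ioo M.tmin M.tmax)) : Measure (Trajectory S M.tmin M.tmax) :=
    if ∑ s, w m s T = 0 then Measure.dirac X else
      ∑ s, ENNReal.ofReal (w m s T / ∑ s, w m s T) • Measure.dirac (M.pathOfCard X m s T)
  have hF : ∀ T, M.resample lam X T = F T.card T := by
    intro T
    have hp : ∀ s, M.pathOfCard X T.card s T = path T s := by intro s; simp [pathOfCard]
    have hw : ∀ s, w T.card s T = M.weight lam T s := fun s => by simp only [w, weight, hp]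
    by_cases h : M.totalWeight lam T = 0
    · have h' : ∑ s, w T.card s T = 0 := by simpa only [hw, totalWeight] using h
      simp only [resample, F, if_pos h, if_pos h']
    · have h' : ¬ ∑ s, w T.card s T = 0 := by simpa only [hw, totalWeight] using h
      simp only [resample, F, if_neg h, if_neg h', hw, hp]
      rfl
  have hs : ∀ n, Measurable fun v : Fin n → Ioo M.tmin M.tmax => M.resample lam X (J ∪ Finset.univ.image v) := by
    intro n
    simp_rw [hF]
    have hc := measurable_count J n (fun _ => True) (by simp)
    simp only [Finset.filter_true] at hc
    have hw : ∀ m s, Measurable fun v : Fin n → Ioo M.tmin M.tmax => w m s (J ∪ Finset.univ.image v) :=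
      fun m s => ((M.measurable_likelihood).comp (M.measurable_pathOfCard X m s J n)).const_mul _
    have hFm : ∀ m, Measurable fun v : Fin n → Ioo M.tmin M.tmax => F m (J ∪ Finset.univ.image v) := by
      intro m
      refine Measurable.ite ?_ measurable_const ?_
      · exact measurableSet_eq_fun (Finset.measurable_sum _ fun s _ => hw m s) measurable_const
      · refine Measure.measurable_of_measurable_coe _ fun B hB => ?_
        simp only [Measure.coe_finsetSum, Finset.sum_apply, Measure.smul_apply, smul_eq_mul]
        refine Finset.measurable_sum _ fun s _ => Measurable.mul ?_ ?_
        · exact ((hw m s).div (Finset.measurable_sum _ fun s _ => hw m s)).ennreal_ofReal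
        · exact (Measure.measurable_coe hB).comp
            (Measure.measurable_dirac.comp (M.measurable_pathOfCard X m s J n))
    have := measurable_from_prod_countable_right (f := fun p : ℕ × (Fin n → Ioo M.tmin M.tmax) =>
      F p.1 (J ∪ Finset.univ.image p.2)) hFm
    exact this.comp (hc.prodMk measurable_id)
  intro B hB
  refine (MeasurableSpace.measurableSet_iInf).2 fun n => ?_
  exact hs n hB

theorem exitRate_le (s : S) : M.exitRate s ≤ M.qmax :=
  le_ciSup (f := fun s => M.exitRate s) (Set.finite_range _).bddAbove s

theorem exitRate_nonneg (s : S) : 0 ≤ M.exitRate s :=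
  Finset.sum_nonneg fun _ h => M.Q_nonneg _ _ (Finset.ne_of_mem_erase h).symm

theorem P_nonneg (lam : ℝ) (h : M.qmax < lam) (s s' : S) : 0 ≤ M.P lam s s' := by
  have h1 := M.exitRate_le s
  have h0 := M.exitRate_nonneg s
  have : 0 < lam := by linarith
  unfold P; split_ifs with hs
  · rw [sub_nonneg, div_le_one this]; linarith
  · exact div_nonneg (M.Q_nonneg _ _ hs) this.le

theorem resample_prob (lam : ℝ) (h : M.qmax < lam) (X) (T) : IsProbabilityMeasure (M.resample lam X T) := by
  unfold resample
  split_ifs with hz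
  · infer_instance
  · constructor
    have hw : ∀ s, 0 ≤ M.weight lam T s := fun s => mul_nonneg (mul_nonneg (M.init_nonneg _)
      (Finset.prod_nonneg fun i _ => M.P_nonneg lam h _ _)) (Finset.prod_nonneg fun j _ => M.L_nonneg _ _)
    simp only [Measure.coe_finsetSum, Finset.sum_apply, Measure.smul_apply, smul_eq_mul, measure_univ, mul_one]
    rw [← ENNReal.ofReal_sum_of_nonneg, ← Finset.sum_div]
    · change ENNReal.ofReal (M.totalWeight lam T / _) = 1
      rw [div_self hz, ENNReal.ofReal_one]
    · exact fun s _ => div_nonneg (hw s) (Finset.sum_nonneg fun s _ => hw s)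

theorem poisson_prob {E : Type*} [MeasurableSpace E] (μ : Measure E) [IsFiniteMeasure μ] :
    IsProbabilityMeasure (poissonProcess μ) := by
  constructor
  unfold poissonProcess
  rw [Measure.sum_apply _ MeasurableSet.univ]
  have : ∀ n : ℕ, Measurable (fun v : Fin n → E => (⟨n, v⟩ : Σ n : ℕ, Fin n → E)) := fun n B hB => MeasurableSpace.measurableSet_iInf.1 hB n
  simp only [Measure.smul_apply, smul_eq_mul, Measure.map_apply (this _) MeasurableSet.univ, preimage_univ, Measure.pi_univ, Finset.prod_const, Finset.card_univ, Fintype.card_fin]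
  have h2 : ∀ n : ℕ, ENNReal.ofReal (Real.exp (-(μ univ).toReal) / n.factorial) * μ univ ^ n =
     ENNReal.ofReal (Real.exp (-(μ univ).toReal) * ((μ univ).toReal ^ n / n.factorial)) := by
    intro n
    conv_lhs => rw [← ENNReal.ofReal_toReal (measure_ne_top μ univ)]
    rw [← ENNReal.ofReal_pow ENNReal.toReal_nonneg, ← ENNReal.ofReal_mul (by positivity)]
    simp only [ENNReal.toReal_ofReal ENNReal.toReal_nonneg]
    ring_nf
  simp_rw [h2]
  have h3 := (NormedSpace.expSeries_div_hasSum_exp ((μ univ).toReal)).mul_left (Real.exp (-(μ univ).toReal))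
  rw [← ENNReal.ofReal_tsum_of_nonneg (fun n => by positivity) h3.summable, h3.tsum_eq, ← Real.exp_eq_exp_ℝ, ← Real.exp_add]
  simp

/-- `A(X, ·)` is a probability measure. -/
theorem kernel_prob (lam : ℝ) (h : M.qmax < lam) (X) : IsProbabilityMeasure (M.kernel lam X) := by
  have : IsFiniteMeasure (M.virtualIntensity lam X) := by
    constructor
    unfold virtualIntensity
    rw [withDensity_apply _ MeasurableSet.univ]
    calc _ ≤ ∫⁻ t in univ, ENNReal.ofReal lam ∂((volume : Measure ℝ).comap (Subtype.val : Ioo M.tmin M.tmax → ℝ)) :=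
          lintegral_mono fun t => ENNReal.ofReal_le_ofReal (by linarith [M.exitRate_nonneg (X.1 (toIcc t))])
      _ < ⊤ := by
          rw [setLIntegral_univ, lintegral_const]
          apply ENNReal.mul_lt_top (by simp)
          rw [MeasurableEmbedding.comap_apply (MeasurableEmbedding.subtype_coe measurableSet_Ioo)]
          simp only [image_univ, Subtype.range_coe]; exact measure_Ioo_lt_top
  have := poisson_prob (M.virtualIntensity lam X)
  have hm := M.measurable_resample lam X (jumps X)
  constructor
  unfold kernel
  rw [Measure.bind_apply MeasurableSet.univ hm.aemeasurable]
  have : ∀ v : Σ n : ℕ, Fin n → Ioo M.tmin M.tmax, M.resample lam X (jumps X ∪ points v) univ = 1 :=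
    fun v => (M.resample_prob lam h X _).measure_univ
  simp [this]
end HiddenMJP

end RaoTeh

end

/-! Fix one skeleton of positive weight whose jump times avoid all observation times. Its weight
depends on the jump times only through their order and their position relative to the observations,
so it equals a constant `w` on an open set `U` of configurations of `n` times
(`exists_isOpen_weight_eq`). Irreducibility supplies the skeleton: states compatible with the
evidence can be joined within arbitrarily short time (`exists_skeleton`).

From any `X`, the virtual jumps have intensity at least `lam - qmax`, so their law dominates a
multiple of Lebesgue measure on `U`, uniformly in `X`. Given such virtual jumps `V`, the skeleton
extends to `J(X) ∪ V` by staying put at the old jump times. This leaves the trajectory `path V s`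
unchanged and costs at most `h` factors, each at least `1 - qmax / lam` (`weight_comp_coarsen`,
`le_resample`). The assumption `lam > qmax` makes both bounds positive. Thus all old jumps are
forgotten with probability bounded below, and the minorizing law is that of `path V s` with `V`
uniform on `U`. -/

open scoped NNReal ENNReal

namespace RaoTeh

/-! ### Refining a set of potential jump times -/

section Refinement

variable {a b : ℝ}

/-- Both sets are initial segments of `T`, hence nested, and comparing their sizes compares the
segments. This translates positions in `T` into times. -/
theorem card_filter_lt_lt_card_filter_le_iff {T : Finset (Ioo a b)} {τ : Ioo a b} (hτ : τ ∈ T)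
    (t : Icc a b) :
    (T.filter (· < τ)).card < (T.filter fun σ : Ioo a b => (σ : ℝ) ≤ t).card ↔ (τ : ℝ) ≤ t := by
  constructor
  · intro hlt
    by_contra! hn
    refine absurd (Finset.card_le_card ?_) (not_le.2 hlt)
    intro σ hσ
    rw [Finset.mem_filter] at hσ ⊢
    exact ⟨hσ.1, Subtype.coe_lt_coe.1 (hσ.2.trans_lt hn)⟩
  · intro hle
    apply Finset.card_lt_card
    rw [Finset.ssubset_iff_of_subset]
    · exact ⟨τ, by simp [hτ, hle], by simp⟩
    · intro σ hσ
      rw [Finset.mem_filter] at hσ ⊢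
      exact ⟨hσ.1, (Subtype.coe_le_coe.2 hσ.2.le).trans hle⟩

theorem card_filter_lt_orderEmbOfFin (T : Finset (Ioo a b)) (i : Fin T.card) :
    (T.filter (· < T.orderEmbOfFin rfl i)).card = i := by
  have : T.filter (· < T.orderEmbOfFin rfl i) =
      (Finset.Iio i).map (T.orderEmbOfFin rfl).toEmbedding := by
    ext τ
    simp only [Finset.mem_filter, Finset.mem_map, Finset.mem_Iio]
    constructor
    · rintro ⟨hτ, hlt⟩
      have : τ ∈ Set.range (T.orderEmbOfFin rfl) := by
        rw [Finset.range_orderEmbOfFin]; exact hτ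
      obtain ⟨j, rfl⟩ := this
      exact ⟨j, (T.orderEmbOfFin rfl).lt_iff_lt.1 hlt, rfl⟩
    · rintro ⟨j, hj, rfl⟩
      exact ⟨T.orderEmbOfFin_mem rfl j, (T.orderEmbOfFin rfl).lt_iff_lt.2 hj⟩
  rw [this, Finset.card_map, Fin.card_Iio]

/-- For `V ⊆ T`, the number of points of `V` among the first `i` points of `T`. -/
noncomputable def coarsen (V T : Finset (Ioo a b)) (i : Fin (T.card + 1)) : Fin (V.card + 1) :=
  ⟨(V.filter fun τ => (T.filter (· < τ)).card < (i : ℕ)).card,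
    Nat.lt_succ_of_le (Finset.card_filter_le _ _)⟩

/-- The index of the interval immediately before the time `t`. -/
noncomputable def indexBefore (V : Finset (Ioo a b)) (t : Ioo a b) : Fin (V.card + 1) :=
  ⟨(V.filter (· < t)).card, Nat.lt_succ_of_le (Finset.card_filter_le _ _)⟩

theorem coarsen_index {V T : Finset (Ioo a b)} (hVT : V ⊆ T) (t : Icc a b) :
    coarsen V T (index T t) = index V t := by
  apply Fin.ext
  simp only [coarsen, index]
  exact congrArg Finset.card (Finset.filter_congr fun τ hτ =>
    card_filter_lt_lt_card_filter_le_iff (hVT hτ) t)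

theorem coarsen_zero (V T : Finset (Ioo a b)) : coarsen V T 0 = 0 := by
  apply Fin.ext
  simp [coarsen]

theorem coarsen_castSucc {V T : Finset (Ioo a b)} (hVT : V ⊆ T) (i : Fin T.card) :
    coarsen V T i.castSucc = indexBefore V (T.orderEmbOfFin rfl i) := by
  apply Fin.ext
  simp only [coarsen, indexBefore, Fin.val_castSucc]
  refine congrArg Finset.card (Finset.filter_congr fun τ hτ => ?_)
  obtain ⟨j, rfl⟩ : τ ∈ Set.range (T.orderEmbOfFin rfl) := by
    rw [Finset.range_orderEmbOfFin]; exact hVT hτ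
  rw [card_filter_lt_orderEmbOfFin, (T.orderEmbOfFin rfl).lt_iff_lt, Fin.lt_def]

theorem coarsen_succ {V T : Finset (Ioo a b)} (hVT : V ⊆ T) (i : Fin T.card) :
    coarsen V T i.succ = index V (toIcc (T.orderEmbOfFin rfl i)) := by
  apply Fin.ext
  simp only [coarsen, index, Fin.val_succ]
  refine congrArg Finset.card (Finset.filter_congr fun τ hτ => ?_)
  obtain ⟨j, rfl⟩ : τ ∈ Set.range (T.orderEmbOfFin rfl) := by
    rw [Finset.range_orderEmbOfFin]; exact hVT hτ
  rw [card_filter_lt_orderEmbOfFin, Nat.lt_succ_iff, ← Fin.le_def,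
    ← (T.orderEmbOfFin rfl).le_iff_le]
  rfl

theorem coarsen_self (V : Finset (Ioo a b)) (i : Fin (V.card + 1)) : coarsen V V i = i := by
  refine Fin.cases (coarsen_zero V V) (fun j => ?_) i
  apply Fin.ext
  rw [coarsen_succ subset_rfl]
  have hmem := V.orderEmbOfFin_mem rfl j
  have : (V.filter fun τ : Ioo a b => (τ : ℝ) ≤ toIcc (V.orderEmbOfFin rfl j)) =
      insert (V.orderEmbOfFin rfl j) (V.filter (· < V.orderEmbOfFin rfl j)) := by
    ext τ
    have hiff : (τ : ℝ) ≤ toIcc (V.orderEmbOfFin rfl j) ↔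
        τ = V.orderEmbOfFin rfl j ∨ τ < V.orderEmbOfFin rfl j := le_iff_eq_or_lt (a := τ)
    rw [Finset.mem_filter, Finset.mem_insert, Finset.mem_filter, hiff]
    constructor
    · rintro ⟨h1, h2 | h2⟩
      · exact Or.inl h2
      · exact Or.inr ⟨h1, h2⟩
    · rintro (h | h)
      · exact ⟨h ▸ hmem, Or.inl h⟩
      · exact ⟨h.1, Or.inr h.2⟩
  simp only [index, Fin.val_succ]
  rw [this, Finset.card_insert_of_notMem (by simp), card_filter_lt_orderEmbOfFin]

/-- The pulled back skeleton does not change at the points of `T \ V`. This is why the resampled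
trajectory need not remember `X`. -/
theorem path_comp_coarsen {S : Type*} {V T : Finset (Ioo a b)} (hVT : V ⊆ T)
    (s : Fin (V.card + 1) → S) : path T (s ∘ coarsen V T) = path V s :=
  Subtype.ext <| funext fun t => congrArg s (coarsen_index hVT t)

/-- Each factor depends only on the intervals of `V` just before and at a point of `T`. Indexed by
points instead of positions, the product can be split over `V` and `T \ V`. -/
theorem prod_coarsen {V T : Finset (Ioo a b)} (hVT : V ⊆ T)
    (f : Fin (V.card + 1) → Fin (V.card + 1) → ℝ) :
    ∏ i : Fin T.card, f (coarsen V T i.castSucc) (coarsen V T i.succ) =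
      ∏ τ ∈ T, f (indexBefore V τ) (index V (toIcc τ)) := by
  simp only [coarsen_castSucc hVT, coarsen_succ hVT]
  rw [← Finset.prod_coe_sort T, ← (T.orderIsoOfFin rfl).toEquiv.prod_comp]
  rfl

theorem indexBefore_eq_index {V : Finset (Ioo a b)} {τ : Ioo a b} (hτ : τ ∉ V) :
    indexBefore V τ = index V (toIcc τ) := by
  apply Fin.ext
  simp only [indexBefore, index, toIcc]
  refine congrArg Finset.card (Finset.filter_congr fun σ hσ => ?_)
  rw [Subtype.coe_le_coe, le_iff_lt_or_eq, or_iff_left]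
  rintro rfl
  exact hτ hσ

end Refinement

/-! ### Skeleton weights under refinement -/

namespace HiddenMJP

variable {S : Type*} [Fintype S] [DecidableEq S] (M : HiddenMJP S)

/-- Every point of `T \ V` only inserts a self-transition; the initial state, the transitions at `V`
and the likelihood are untouched. -/
theorem weight_comp_coarsen (lam : ℝ) {V T : Finset (Ioo M.tmin M.tmax)} (hVT : V ⊆ T)
    (s : Fin (V.card + 1) → S) :
    M.weight lam T (s ∘ coarsen V T) = M.weight lam V s *
      ∏ τ ∈ T \ V, M.P lam (s (index V (toIcc τ))) (s (index V (toIcc τ))) := by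
  have h1 := prod_coarsen hVT fun i j => M.P lam (s i) (s j)
  have h2 := prod_coarsen (subset_refl V) fun i j => M.P lam (s i) (s j)
  simp only [coarsen_self] at h2
  have h3 : ∏ τ ∈ T \ V, M.P lam (s (indexBefore V τ)) (s (index V (toIcc τ))) =
      ∏ τ ∈ T \ V, M.P lam (s (index V (toIcc τ))) (s (index V (toIcc τ))) :=
    Finset.prod_congr rfl fun τ hτ => by
      rw [indexBefore_eq_index (Finset.mem_sdiff.1 hτ).2]
  simp only [weight, path_comp_coarsen hVT, Function.comp_apply, coarsen_zero, h1, h2,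
    ← Finset.prod_sdiff hVT, h3]
  ring

theorem qmax_nonneg [Nonempty S] : 0 ≤ M.qmax :=
  (M.exitRate_nonneg (Classical.arbitrary S)).trans (M.exitRate_le _)

omit [DecidableEq S] in
theorem nonempty (M : HiddenMJP S) : Nonempty S := by
  by_contra hn
  rw [not_nonempty_iff] at hn
  simpa using M.init_sum

theorem lam_pos {lam : ℝ} (hlam : M.qmax < lam) : 0 < lam :=
  have := M.nonempty
  M.qmax_nonneg.trans_lt hlam

theorem P_le_one {lam : ℝ} (hlam : M.qmax < lam) (s s' : S) : M.P lam s s' ≤ 1 := by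
  have hpos := M.lam_pos hlam
  unfold P
  split_ifs with hs
  · exact sub_le_self _ (div_nonneg (M.exitRate_nonneg s) hpos.le)
  · rw [div_le_one hpos]
    refine le_trans ?_ ((M.exitRate_le s).trans hlam.le)
    exact Finset.single_le_sum (f := M.Q s)
      (fun x hx => M.Q_nonneg _ _ (Finset.ne_of_mem_erase hx).symm)
      (Finset.mem_erase.2 ⟨Ne.symm hs, Finset.mem_univ _⟩)

theorem one_sub_qmax_div_le_P {lam : ℝ} (hlam : M.qmax < lam) (s : S) :
    1 - M.qmax / lam ≤ M.P lam s s := by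
  have := M.lam_pos hlam
  rw [P, if_pos rfl]
  have := div_le_div_of_nonneg_right (M.exitRate_le s) this.le
  linarith

theorem one_sub_qmax_div_pos {lam : ℝ} (hlam : M.qmax < lam) : 0 < 1 - M.qmax / lam := by
  rw [sub_pos, div_lt_one (M.lam_pos hlam)]
  exact hlam

theorem weight_nonneg {lam : ℝ} (hlam : M.qmax < lam) (T : Finset (Ioo M.tmin M.tmax))
    (s : Fin (T.card + 1) → S) : 0 ≤ M.weight lam T s :=
  mul_nonneg (mul_nonneg (M.init_nonneg _) (Finset.prod_nonneg fun _ _ => M.P_nonneg lam hlam _ _))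
    (Finset.prod_nonneg fun _ _ => M.L_nonneg _ _)

omit [DecidableEq S] in
theorem init_le_one (s : S) : M.init s ≤ 1 := by
  rw [← M.init_sum]
  exact Finset.single_le_sum (fun x _ => M.init_nonneg x) (Finset.mem_univ s)

/-- A bound for the likelihood of any trajectory. -/
noncomputable def likelihoodBound : ℝ := ∏ j, ∑ s, M.L j s

omit [DecidableEq S] in
theorem likelihood_le (X : Trajectory S M.tmin M.tmax) : M.likelihood X ≤ M.likelihoodBound :=
  Finset.prod_le_prod (fun _ _ => M.L_nonneg _ _) fun j _ =>
    Finset.single_le_sum (fun s _ => M.L_nonneg j s) (Finset.mem_univ _)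

theorem weight_le {lam : ℝ} (hlam : M.qmax < lam) (T : Finset (Ioo M.tmin M.tmax))
    (s : Fin (T.card + 1) → S) : M.weight lam T s ≤ M.likelihoodBound := by
  have h1 : M.init (s 0) * ∏ i : Fin T.card, M.P lam (s i.castSucc) (s i.succ) ≤ 1 :=
    mul_le_one₀ (M.init_le_one _) (Finset.prod_nonneg fun _ _ => M.P_nonneg lam hlam _ _)
      (Finset.prod_le_one (fun _ _ => M.P_nonneg lam hlam _ _) fun _ _ => M.P_le_one hlam _ _)
  calc M.weight lam T s ≤ 1 * M.likelihood (path T s) :=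
        mul_le_mul_of_nonneg_right h1 (Finset.prod_nonneg fun _ _ => M.L_nonneg _ _)
    _ ≤ M.likelihoodBound := by rw [one_mul]; exact M.likelihood_le _

theorem totalWeight_le {lam : ℝ} (hlam : M.qmax < lam) (T : Finset (Ioo M.tmin M.tmax)) :
    M.totalWeight lam T ≤ (Fintype.card S : ℝ) ^ (T.card + 1) * M.likelihoodBound := by
  calc M.totalWeight lam T ≤ ∑ _s : Fin (T.card + 1) → S, M.likelihoodBound :=
        Finset.sum_le_sum fun s _ => M.weight_le hlam T s
    _ = _ := by simp

/-- The trajectory of a skeleton on the potential jump times `V` survives the refinement of `V` by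
at most `h` further potential jump times with a probability bounded below. -/
theorem le_resample {lam : ℝ} (hlam : M.qmax < lam) (X : Trajectory S M.tmin M.tmax)
    {J V : Finset (Ioo M.tmin M.tmax)} {h : ℕ} (hJ : J.card ≤ h) (s : Fin (V.card + 1) → S)
    (hs : 0 < M.weight lam V s) {B : Set (Trajectory S M.tmin M.tmax)} (hB : path V s ∈ B) :
    ENNReal.ofReal (M.weight lam V s * (1 - M.qmax / lam) ^ h /
      ((Fintype.card S : ℝ) ^ (h + V.card + 1) * M.likelihoodBound)) ≤
      M.resample lam X (J ∪ V) B := by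
  have := M.nonempty
  set T := J ∪ V with hT
  have hVT : V ⊆ T := Finset.subset_union_right
  have hp := M.one_sub_qmax_div_pos hlam
  have hp1 : 1 - M.qmax / lam ≤ 1 :=
    sub_le_self _ (div_nonneg M.qmax_nonneg (M.lam_pos hlam).le)
  have hcard : (T \ V).card ≤ h := by
    refine (Finset.card_le_card ?_).trans hJ
    rw [hT, Finset.union_sdiff_right]
    exact Finset.sdiff_subset
  have hw : M.weight lam V s * (1 - M.qmax / lam) ^ h ≤ M.weight lam T (s ∘ coarsen V T) := by
    rw [M.weight_comp_coarsen lam hVT]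
    refine mul_le_mul_of_nonneg_left ?_ hs.le
    calc (1 - M.qmax / lam) ^ h ≤ (1 - M.qmax / lam) ^ (T \ V).card :=
          pow_le_pow_of_le_one hp.le hp1 hcard
      _ ≤ _ := by
          rw [← Finset.prod_const]
          exact Finset.prod_le_prod (fun _ _ => hp.le) fun _ _ => M.one_sub_qmax_div_le_P hlam _
  have hwpos : 0 < M.weight lam T (s ∘ coarsen V T) := lt_of_lt_of_le (by positivity) hw
  have hle : M.weight lam T (s ∘ coarsen V T) ≤ M.totalWeight lam T :=
    Finset.single_le_sum (f := M.weight lam T) (fun s _ => M.weight_nonneg hlam T s)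
      (Finset.mem_univ _)
  have htot : 0 < M.totalWeight lam T := hwpos.trans_le hle
  have hL : 0 < M.likelihoodBound := hwpos.trans_le (M.weight_le hlam _ _)
  -- There are `|S| ^ (|T| + 1)` skeletons on `T`, each of weight at most `likelihoodBound`, and
  -- `|T| ≤ h + |V|`.
  have htot' : M.totalWeight lam T ≤
      (Fintype.card S : ℝ) ^ (h + V.card + 1) * M.likelihoodBound := by
    refine (M.totalWeight_le hlam T).trans (mul_le_mul_of_nonneg_right ?_ hL.le)
    refine pow_le_pow_right₀ (by exact_mod_cast Fintype.card_pos) ?_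
    have : T.card ≤ J.card + V.card := Finset.card_union_le J V
    omega
  rw [resample, if_neg htot.ne']
  simp only [Measure.coe_finsetSum, Finset.sum_apply, Measure.smul_apply, smul_eq_mul]
  calc _ ≤ ENNReal.ofReal (M.weight lam T (s ∘ coarsen V T) / M.totalWeight lam T) :=
        ENNReal.ofReal_le_ofReal (div_le_div₀ hwpos.le hw htot htot')
    _ = ENNReal.ofReal (M.weight lam T (s ∘ coarsen V T) / M.totalWeight lam T) *
          Measure.dirac (path T (s ∘ coarsen V T)) B := by
        rw [path_comp_coarsen hVT, Measure.dirac_apply_of_mem hB, mul_one]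
    _ ≤ _ := Finset.single_le_sum (f := fun s => ENNReal.ofReal (M.weight lam T s /
          M.totalWeight lam T) * Measure.dirac (path T s) B) (fun _ _ => zero_le)
          (Finset.mem_univ _)

end HiddenMJP

end RaoTeh

/-! ### Existence of a skeleton of positive weight -/

namespace RaoTeh
namespace HiddenMJP

variable {S : Type*} [Fintype S] [DecidableEq S] (M : HiddenMJP S)

/-- Some term of the sum is nonzero, hence so are all its factors. Compatibility between successive
observations is not recorded, since irreducibility restores it; only an observation at `tmin` leaves
no time to move. -/
theorem Possible.exists_states {M : HiddenMJP S} (hposs : M.Possible) :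
    ∃ (s₀ : S) (g : Fin M.k → S), 0 < M.init s₀ ∧ (∀ j, 0 < M.L j (g j)) ∧
      ∀ j, (M.tobs j : ℝ) = M.tmin → g j = s₀ := by
  obtain ⟨g, -, hg⟩ := Finset.exists_ne_zero_of_sum_ne_zero (ne_of_gt hposs)
  split_ifs at hg with hL
  · have hL' := Finset.prod_ne_zero_iff.1 hL.ne'
    obtain ⟨s₀, -, hs₀⟩ := Finset.exists_ne_zero_of_sum_ne_zero hg
    refine ⟨s₀, g, (M.init_nonneg s₀).lt_of_ne' (left_ne_zero_of_mul hs₀),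
      fun j => (M.L_nonneg j _).lt_of_ne' (hL' j (Finset.mem_univ j)),
      fun j hj => ?_⟩
    have hfac := Finset.prod_ne_zero_iff.1 (right_ne_zero_of_mul hs₀) j (Finset.mem_univ j)
    -- Only the first observation can occur at `tmin`; its time increment is then zero and its
    -- transition matrix is the identity.
    have hj0 : j.castSucc = 0 := by
      rw [← Fin.val_eq_zero_iff, Fin.val_castSucc]
      by_contra hne
      have : M.tobs ⟨0, by omega⟩ < M.tobs j :=
        M.tobs_strictMono (Fin.lt_def.2 (Nat.pos_of_ne_zero hne))
      have h1 : (M.tobs ⟨0, by omega⟩ : ℝ) < M.tobs j := this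
      exact absurd h1 (not_lt.2 (hj.trans_le (M.tobs _).2.1))
    by_contra hne
    rw [hj0] at hfac
    simp only [Fin.cons_zero, hj, sub_self, zero_smul, NormedSpace.exp_zero] at hfac
    exact hfac (Matrix.one_apply_ne' hne)
  · exact absurd rfl hg

/-- Before each observation, the open gap since the previous one has room for any finite chain of
transitions leading to the required state. Sequences indexed by `ℕ` let a jump be appended without
casts. -/
theorem exists_skeleton {lam : ℝ} (hlam : 0 < lam) (hirr : M.Irreducible) (s₀ : S)
    (g : Fin M.k → S) (hg : ∀ j, (M.tobs j : ℝ) = M.tmin → g j = s₀) :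
    ∃ (n : ℕ) (v : ℕ → ℝ) (s : ℕ → S), s 0 = s₀ ∧ (∀ i < n, 0 < M.P lam (s i) (s (i + 1))) ∧
      (∀ i < n, v i ∈ Ioo M.tmin M.tmax) ∧ (∀ i < n, ∀ j < i, v j < v i) ∧
      ∀ j, (∀ i < n, v i ≠ M.tobs j) ∧
        s ((Finset.range n).filter fun i => v i ≤ M.tobs j).card = g j := by
  /- A partial skeleton up to the time `c`, where it is in the state `x`. -/
  let R (c : ℝ) (x : S) : Prop :=
    ∃ (n : ℕ) (v : ℕ → ℝ) (s : ℕ → S), s 0 = s₀ ∧ s n = x ∧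
      (∀ i < n, 0 < M.P lam (s i) (s (i + 1))) ∧
      (∀ i < n, v i ∈ Ioo M.tmin c) ∧ (∀ i < n, ∀ j < i, v j < v i) ∧
      ∀ j, (∀ i < n, v i ≠ M.tobs j) ∧ ((M.tobs j : ℝ) ≤ c →
        s ((Finset.range n).filter fun i => v i ≤ M.tobs j).card = g j)
  -- Time passes without a jump. A new observation can only occur at `c'` itself; all jumps precede
  -- it, so it sees the final state `x`.
  have wait : ∀ c c' x, R c x → c ≤ c' → (∀ j, (M.tobs j : ℝ) ≤ c ∨ c' ≤ M.tobs j) →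
      (∀ j, (M.tobs j : ℝ) = c' → g j = x) → R c' x := by
    rintro c c' x ⟨n, v, s, h0, hn, hP, hv, hmono, hobs⟩ hcc hno hx
    refine ⟨n, v, s, h0, hn, hP, fun i hi => ⟨(hv i hi).1, (hv i hi).2.trans_le hcc⟩, hmono,
      fun j => ⟨(hobs j).1, fun hj => ?_⟩⟩
    rcases hno j with h | h
    · exact (hobs j).2 h
    · rw [hx j (le_antisymm hj h), Finset.filter_true_of_mem, Finset.card_range, hn]
      exact fun i hi => ((hv i (Finset.mem_range.1 hi)).2.trans_le (hcc.trans h)).le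
  -- One jump is appended strictly between `c` and `c'`, where there is no observation, so earlier
  -- observations are unaffected.
  have jump : ∀ c c' x y, R c x → M.tmin ≤ c → c < c' →
      (∀ j, (M.tobs j : ℝ) ≤ c ∨ c' < M.tobs j) → 0 < M.P lam x y → R c' y := by
    rintro c c' x y ⟨n, v, s, h0, hn, hP, hv, hmono, hobs⟩ hc hcc hno hxy
    obtain ⟨τ, hτ, hτ'⟩ := exists_between hcc
    have hvu : ∀ i < n, Function.update v n τ i = v i :=
      fun i hi => Function.update_of_ne hi.ne _ _
    have hsu : ∀ i ≤ n, Function.update s (n + 1) y i = s i :=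
      fun i hi => Function.update_of_ne (by omega) _ _
    refine ⟨n + 1, Function.update v n τ, Function.update s (n + 1) y, ?_, ?_, ?_, ?_, ?_, ?_⟩
    · rw [hsu 0 n.zero_le, h0]
    · rw [Function.update_self]
    · intro i hi
      rcases Nat.lt_succ_iff_lt_or_eq.1 hi with h | rfl
      · rw [hsu i h.le, hsu (i + 1) h]
        exact hP i h
      · rw [hsu i le_rfl, Function.update_self, hn]
        exact hxy
    · intro i hi
      rcases Nat.lt_succ_iff_lt_or_eq.1 hi with h | rfl
      · rw [hvu i h]
        exact ⟨(hv i h).1, (hv i h).2.trans hcc⟩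
      · rw [Function.update_self]
        exact ⟨hc.trans_lt hτ, hτ'⟩
    · intro i hi j hj
      rw [hvu j (by omega)]
      rcases Nat.lt_succ_iff_lt_or_eq.1 hi with h | rfl
      · rw [hvu i h]
        exact hmono i h j hj
      · rw [Function.update_self]
        exact (hv j hj).2.trans hτ
    · intro j
      constructor
      · intro i hi
        rcases Nat.lt_succ_iff_lt_or_eq.1 hi with h | rfl
        · rw [hvu i h]
          exact (hobs j).1 i h
        · rw [Function.update_self]
          rintro rfl
          rcases hno j with h | h <;> linarith
      · intro hj
        have hjc : (M.tobs j : ℝ) ≤ c := (hno j).resolve_right (not_lt.2 hj)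
        have : ((Finset.range (n + 1)).filter fun i => Function.update v n τ i ≤ M.tobs j) =
            (Finset.range n).filter fun i => v i ≤ M.tobs j := by
          rw [Finset.range_add_one, Finset.filter_insert, if_neg]
          · exact Finset.filter_congr fun i hi => by rw [hvu i (Finset.mem_range.1 hi)]
          · rw [Function.update_self, not_le]
            exact hjc.trans_lt hτ
        rw [this, hsu, (hobs j).2 hjc]
        exact (Finset.card_filter_le _ _).trans_eq (Finset.card_range n)
  -- Induction along the chain of transitions: the available time is split at an intermediate `e`,
  -- the last jump being kept for `(e, c')`.
  have travel : ∀ (c d : ℝ) x y, R c x → M.tmin ≤ c → (∀ j, (M.tobs j : ℝ) ≤ c ∨ d ≤ M.tobs j) →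
      Relation.ReflTransGen (fun x y => x ≠ y ∧ 0 < M.Q x y) x y →
      ∀ c', c < c' → c' < d → R c' y := by
    intro c d x y hx hc hno hxy
    induction hxy with
    | refl =>
      intro c' h1 h2
      refine wait c c' x hx h1.le (fun j => (hno j).imp_right h2.le.trans) fun j hj => ?_
      rcases hno j with h | h <;> linarith
    | tail _ hstep ih =>
      intro c' h1 h2
      obtain ⟨e, he, he'⟩ := exists_between h1
      refine jump e c' _ _ (ih e he (he'.trans h2)) (hc.trans he.le) he'
        (fun j => (hno j).imp (fun h => h.trans he.le) h2.trans_le) ?_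
      rw [P, if_neg hstep.1]
      exact div_pos hstep.2 hlam
  -- Induction on the number `m` of observations already matched, with `c` not beyond the remaining
  -- ones.
  have main : ∀ m ≤ M.k, ∃ c x, R c x ∧ M.tmin ≤ c ∧ c ≤ M.tmax ∧
      ∀ j : Fin M.k, ((j : ℕ) < m → (M.tobs j : ℝ) ≤ c) ∧ (m ≤ (j : ℕ) → c ≤ M.tobs j) := by
    intro m
    induction m with
    | zero =>
      refine fun _ => ⟨M.tmin, s₀, ⟨0, fun _ => 0, fun _ => s₀, rfl, rfl, by simp, by simp,
        by simp, fun j => ⟨by simp, fun hj => (hg j (le_antisymm hj (M.tobs j).2.1)).symm⟩⟩,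
        le_rfl, M.tmin_lt_tmax.le, fun j => ⟨by simp, fun _ => (M.tobs j).2.1⟩⟩
    | succ m ih =>
      intro hm
      obtain ⟨c, x, hR, hc, hc', hj⟩ := ih (by omega)
      let jm : Fin M.k := ⟨m, hm⟩
      have hlt : ∀ j : Fin M.k, m + 1 ≤ (j : ℕ) → (M.tobs jm : ℝ) < M.tobs j :=
        fun j h => M.tobs_strictMono (Fin.lt_def.2 h)
      have hle : ∀ j : Fin M.k, (j : ℕ) < m + 1 → (M.tobs j : ℝ) ≤ M.tobs jm :=
        fun j h => M.tobs_strictMono.monotone (Fin.le_def.2 (Nat.lt_succ_iff.1 h))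
      have hord : ∀ j : Fin M.k, ((j : ℕ) < m + 1 → (M.tobs j : ℝ) ≤ M.tobs jm) ∧
          (m + 1 ≤ (j : ℕ) → (M.tobs jm : ℝ) ≤ M.tobs j) := fun j => ⟨hle j, fun h => (hlt j h).le⟩
      -- If `c` is already the next observation time, as for an observation at `tmin`, then `R c x`
      -- includes it. Otherwise the state `g jm` is reached at an earlier time `e` and held.
      rcases ((hj jm).2 le_rfl).eq_or_lt with heq | hcm
      · rw [heq] at hR hc hc'
        exact ⟨_, x, hR, hc, hc', hord⟩
      · have hno : ∀ j, (M.tobs j : ℝ) ≤ c ∨ (M.tobs jm : ℝ) ≤ M.tobs j := fun j => by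
          rcases lt_or_ge (j : ℕ) m with h | h
          · exact Or.inl ((hj j).1 h)
          · exact Or.inr (M.tobs_strictMono.monotone (Fin.le_def.2 h))
        obtain ⟨e, he, he'⟩ := exists_between hcm
        have hRe := travel c _ x (g jm) hR hc hno (hirr _ _) e he he'
        refine ⟨_, g jm, wait e _ _ hRe he'.le (fun j => (hno j).imp_left (·.trans he.le)) ?_,
          hc.trans hcm.le, (M.tobs jm).2.2, hord⟩
        intro j hjj
        rw [M.tobs_strictMono.injective (Subtype.ext hjj)]
  obtain ⟨c, x, ⟨n, v, s, h0, -, hP, hv, hmono, hobs⟩, -, hc, hj⟩ := main M.k le_rfl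
  exact ⟨n, v, s, h0, hP, fun i hi => ⟨(hv i hi).1, (hv i hi).2.trans_le hc⟩, hmono,
    fun j => ⟨(hobs j).1, (hobs j).2 ((hj j).1 j.2)⟩⟩

end HiddenMJP
end RaoTeh

namespace RaoTeh

/-! ### Lower bounds for Poisson processes -/

section Poisson

variable {E : Type*} [MeasurableSpace E]

/-- The product outer measure is the largest one bounded on boxes by the product of the side
measures, so comparing boxes suffices, without finiteness assumptions. -/
theorem measure_pi_mono {ι : Type*} [Fintype ι] {μ ν : ι → Measure E}
    (h : ∀ i, μ i ≤ ν i) : Measure.pi μ ≤ Measure.pi ν := by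
  refine Measure.le_iff.2 fun A hA => ?_
  rw [Measure.pi, Measure.pi, toMeasure_apply _ _ hA, toMeasure_apply _ _ hA]
  refine OuterMeasure.le_pi.2 (fun s _ => ?_) A
  exact (OuterMeasure.pi_pi_le _ s).trans (Finset.prod_le_prod' fun i _ => h i (s i))

theorem pow_smul_pi_le {n : ℕ} {μ ν : Measure E} [IsFiniteMeasure ν] {c : ℝ≥0} (h : c • ν ≤ μ) :
    c ^ n • Measure.pi (fun _ : Fin n => ν) ≤ Measure.pi fun _ : Fin n => μ := by
  refine le_of_eq_of_le ?_ (measure_pi_mono fun _ => h)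
  refine (Measure.pi_eq fun s _ => ?_).symm
  simp only [Measure.smul_apply, Measure.pi_pi, ENNReal.smul_def, smul_eq_mul,
    Finset.prod_mul_distrib, Finset.prod_const, Finset.card_univ, Fintype.card_fin,
    ENNReal.coe_pow]

/-- Only the part of the mixture with exactly `n` points is kept. -/
theorem mul_lintegral_pi_le_lintegral_poisson (μ : Measure E) (n : ℕ)
    {f : (Σ n : ℕ, Fin n → E) → ℝ≥0∞} (hf : Measurable f) :
    ENNReal.ofReal (Real.exp (-(μ univ).toReal) / (Nat.factorial n : ℝ)) *
        ∫⁻ w, f ⟨n, w⟩ ∂(Measure.pi fun _ : Fin n => μ) ≤ ∫⁻ v, f v ∂(poissonProcess μ) := by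
  have hm : Measurable fun v : Fin n → E => (⟨n, v⟩ : Σ n : ℕ, Fin n → E) :=
    fun B hB => MeasurableSpace.measurableSet_iInf.1 hB n
  rw [poissonProcess, lintegral_sum_measure]
  refine le_trans (le_of_eq ?_) (ENNReal.le_tsum n)
  rw [lintegral_smul_measure, lintegral_map hf hm, smul_eq_mul]

end Poisson

/-! ### Uniform intensity bounds and an open set of good configurations -/

namespace HiddenMJP

variable {S : Type*} [Fintype S] [DecidableEq S] (M : HiddenMJP S)

/-- Lebesgue measure on the time interval. -/
noncomputable def timeMeasure : Measure (Ioo M.tmin M.tmax) :=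
  (volume : Measure ℝ).comap Subtype.val

instance : IsFiniteMeasure M.timeMeasure := by
  constructor
  rw [timeMeasure, (MeasurableEmbedding.subtype_coe measurableSet_Ioo).comap_apply, image_univ,
    Subtype.range_coe]
  exact measure_Ioo_lt_top

instance : M.timeMeasure.IsOpenPosMeasure := by
  refine ⟨fun U hU hne => ?_⟩
  rw [timeMeasure, (MeasurableEmbedding.subtype_coe measurableSet_Ioo).comap_apply]
  exact ((isOpen_Ioo.isOpenMap_subtype_val U hU).measure_pos volume (hne.image _)).ne'

theorem smul_timeMeasure_le_virtualIntensity {lam : ℝ} (X : Trajectory S M.tmin M.tmax) :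
    (lam - M.qmax).toNNReal • M.timeMeasure ≤ M.virtualIntensity lam X := by
  rw [virtualIntensity, ← timeMeasure, ENNReal.smul_def, ← withDensity_const]
  refine withDensity_mono (ae_of_all _ fun t => ?_)
  exact ENNReal.ofReal_le_ofReal (sub_le_sub_left (M.exitRate_le _) _)

/-- An upper bound is needed as well as the lower one, because the total mass enters the Poisson law
through `exp (-m)`. -/
theorem virtualIntensity_univ_le {lam : ℝ} (hlam : M.qmax < lam)
    (X : Trajectory S M.tmin M.tmax) :
    (M.virtualIntensity lam X univ).toReal ≤ lam * (M.timeMeasure univ).toReal := by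
  have hpos := M.lam_pos hlam
  have : M.virtualIntensity lam X ≤ ENNReal.ofReal lam • M.timeMeasure := by
    rw [virtualIntensity, ← timeMeasure, ← withDensity_const]
    refine withDensity_mono (ae_of_all _ fun t => ?_)
    exact ENNReal.ofReal_le_ofReal (sub_le_self _ (M.exitRate_nonneg _))
  have h1 := ENNReal.toReal_mono (by simp [ENNReal.mul_eq_top]) (this univ)
  rwa [Measure.smul_apply, smul_eq_mul, ENNReal.toReal_mul, ENNReal.toReal_ofReal hpos.le] at h1

/-- For a skeleton on `ℕ`, the weight sees `V` only through its size and its counts up to the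
observation times. -/
theorem weight_nat (lam : ℝ) (V : Finset (Ioo M.tmin M.tmax)) (s : ℕ → S) :
    M.weight lam V (fun i => s i) =
      (M.init (s 0) * ∏ i ∈ Finset.range V.card, M.P lam (s i) (s (i + 1))) *
        ∏ j, M.L j (s (V.filter fun τ : Ioo M.tmin M.tmax => (τ : ℝ) ≤ M.tobs j).card) := by
  rw [Finset.prod_range]
  rfl

/-- A skeleton of positive weight has the same weight on an open set of configurations of
potential jump times. -/
theorem exists_isOpen_weight_eq {lam : ℝ} (hlam : M.qmax < lam) (hposs : M.Possible)
    (hirr : M.Irreducible) :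
    ∃ (n : ℕ) (s : ℕ → S) (w : ℝ) (U : Set (Fin n → Ioo M.tmin M.tmax)), 0 < w ∧ IsOpen U ∧
      U.Nonempty ∧ ∀ v ∈ U, (Finset.univ.image v).card = n ∧
        M.weight lam (Finset.univ.image v) (fun i => s i) = w := by
  obtain ⟨s₀, g, hs₀, hL, hg⟩ := hposs.exists_states
  obtain ⟨n, v, s, h0, hP, hv, hmono, hobs⟩ := M.exists_skeleton (M.lam_pos hlam) hirr s₀ g hg
  let v₀ : Fin n → Ioo M.tmin M.tmax := fun i => ⟨v i, hv i i.2⟩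
  let G : Set (Fin n → Ioo M.tmin M.tmax) := {w | (∀ i j, j < i → w j < w i) ∧
    ∀ i j, ((w i : ℝ) ≤ M.tobs j ↔ (v₀ i : ℝ) ≤ M.tobs j)}
  -- At `v₀` all these comparisons are strict, since the jump times are increasing and avoid the
  -- observations; hence they persist nearby.
  have hG : G ∈ 𝓝 v₀ := by
    have hc : ∀ i, Tendsto (fun w : Fin n → Ioo M.tmin M.tmax => (w i : ℝ)) (𝓝 v₀) (𝓝 (v₀ i)) :=
      fun i => (continuous_subtype_val.comp (continuous_apply i)).continuousAt
    refine inter_mem ?_ ?_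
    · refine eventually_all.2 fun i => eventually_all.2 fun j => eventually_imp_distrib_left.2
        fun hij => ?_
      exact (hc j).eventually_lt (hc i) (hmono i i.2 j hij)
    · refine eventually_all.2 fun i => eventually_all.2 fun j => ?_
      rcases lt_or_gt_of_ne ((hobs j).1 i i.2) with h | h
      · filter_upwards [(hc i).eventually (gt_mem_nhds h)] with w hw
        exact ⟨fun _ => h.le, fun _ => hw.le⟩
      · filter_upwards [(hc i).eventually (lt_mem_nhds h)] with w hw
        exact ⟨fun h1 => absurd hw (not_lt.2 h1), fun h1 => absurd h (not_lt.2 h1)⟩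
  obtain ⟨U, hUG, hU, hvU⟩ := mem_nhds_iff.1 hG
  refine ⟨n, s, (M.init (s 0) * ∏ i ∈ Finset.range n, M.P lam (s i) (s (i + 1))) *
    ∏ j, M.L j (g j), U, ?_, hU, ⟨v₀, hvU⟩, fun w hw => ?_⟩
  · exact mul_pos (mul_pos (h0 ▸ hs₀) (Finset.prod_pos fun i hi => hP i (Finset.mem_range.1 hi)))
      (Finset.prod_pos fun j _ => hL j)
  · have hinj : Function.Injective w :=
      StrictMono.injective fun i j hij => (hUG hw).1 j i hij
    have hcard : (Finset.univ.image w).card = n := by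
      rw [Finset.card_image_of_injective _ hinj, Finset.card_univ, Fintype.card_fin]
    refine ⟨hcard, ?_⟩
    rw [weight_nat, hcard]
    congr 1
    refine Finset.prod_congr rfl fun j _ => ?_
    rw [← (hobs j).2]
    congr 2
    rw [Finset.filter_image, Finset.card_image_of_injective _ hinj, Finset.card_filter,
      Finset.card_filter, Finset.sum_range]
    exact Finset.sum_congr rfl fun i _ => if_congr ((hUG hw).2 i j) rfl rfl

end HiddenMJP

end RaoTeh

/-! ### The minorization -/

open RaoTeh HiddenMJP in
theorem proposition2 {S : Type*} [Fintype S] [DecidableEq S] (M : RaoTeh.HiddenMJP S)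
    (hposs : M.Possible) (hirr : M.Irreducible) (lam : ℝ) (hlam : M.qmax < lam) (h : ℕ) :
    RaoTeh.IsOneSmall (M.kernel lam)
      {X : RaoTeh.Trajectory S M.tmin M.tmax | (RaoTeh.jumps X).card ≤ h} := by
  have := M.nonempty
  obtain ⟨n, s, w, U, hw, hU, hUne, hUw⟩ := M.exists_isOpen_weight_eq hlam hposs hirr
  -- A default value for configurations with coinciding points; it makes `Φ` total and is never
  -- taken on `U`.
  let X₀ : Trajectory S M.tmin M.tmax := path ∅ fun _ => Classical.arbitrary S
  let Φ : (Fin n → Ioo M.tmin M.tmax) → Trajectory S M.tmin M.tmax := fun v =>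
    M.pathOfCard X₀ n (fun i => s i) (∅ ∪ Finset.univ.image v)
  have hΦ : Measurable Φ := M.measurable_pathOfCard X₀ n _ ∅ n
  have hΦU : ∀ v ∈ U, Φ v = path (Finset.univ.image v) fun i => s i := fun v hv => by
    simp only [Φ]
    rw [Finset.empty_union, pathOfCard, dif_pos (hUw v hv).1]
    rfl
  let π := Measure.pi fun _ : Fin n => M.timeMeasure
  have hπ0 : π U ≠ 0 := (hU.measure_pos π hUne).ne'
  have hπtop : π U ≠ ⊤ := measure_ne_top π U
  -- The bound of `le_resample` for the skeleton `s`, the same for all configurations in `U`.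
  let κ : ℝ := w * (1 - M.qmax / lam) ^ h /
    ((Fintype.card S : ℝ) ^ (h + n + 1) * M.likelihoodBound)
  have hκ : 0 < κ := by
    obtain ⟨v, hv⟩ := hUne
    have hL : 0 < M.likelihoodBound := by
      refine lt_of_lt_of_le hw ?_
      rw [← (hUw v hv).2]
      exact M.weight_le hlam _ _
    have := M.one_sub_qmax_div_pos hlam
    positivity
  let ρ : ℝ := Real.exp (-(lam * (M.timeMeasure univ).toReal)) / n.factorial
  have hδ : 0 < lam - M.qmax := sub_pos.2 hlam
  -- The factors of `β` bound the Poisson weight of `n` points, the resampling probability and the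
  -- density of the virtual jumps; `π U` compensates the normalization of the minorizing measure.
  refine ⟨ρ * κ * (lam - M.qmax) ^ n * (π U).toReal, (π U)⁻¹ • (π.restrict U).map Φ, ?_, ?_, ?_⟩
  · have := ENNReal.toReal_pos hπ0 hπtop
    positivity
  · constructor
    rw [Measure.smul_apply, Measure.map_apply hΦ MeasurableSet.univ, preimage_univ,
      Measure.restrict_apply_univ, smul_eq_mul, ENNReal.inv_mul_cancel hπ0 hπtop]
  · intro X hX B hB
    have hm := M.measurable_resample lam X (jumps X)
    have hA : MeasurableSet (Φ ⁻¹' B ∩ U) := (hΦ hB).inter hU.measurableSet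
    let μ := Measure.pi fun _ : Fin n => M.virtualIntensity lam X
    have hres : ∀ v ∈ Φ ⁻¹' B ∩ U,
        ENNReal.ofReal κ ≤ M.resample lam X (jumps X ∪ points ⟨n, v⟩) B := by
      rintro v ⟨hvB, hvU⟩
      obtain ⟨hc, hwv⟩ := hUw v hvU
      have := M.le_resample hlam X hX (V := Finset.univ.image v) (fun i => s i)
        (hwv ▸ hw) (B := B) (hΦU v hvU ▸ hvB)
      rwa [hwv, hc] at this
    have hμ : ENNReal.ofReal ((lam - M.qmax) ^ n) * π (Φ ⁻¹' B ∩ U) ≤ μ (Φ ⁻¹' B ∩ U) := by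
      have := pow_smul_pi_le (n := n) (M.smul_timeMeasure_le_virtualIntensity (lam := lam) X)
        (Φ ⁻¹' B ∩ U)
      rwa [Measure.smul_apply, ENNReal.smul_def, smul_eq_mul, ENNReal.coe_pow,
        ← ENNReal.ofReal, ← ENNReal.ofReal_pow hδ.le] at this
    calc ENNReal.ofReal (ρ * κ * (lam - M.qmax) ^ n * (π U).toReal) *
          ((π U)⁻¹ • (π.restrict U).map Φ) B
        = ENNReal.ofReal ρ * (ENNReal.ofReal κ *
            (ENNReal.ofReal ((lam - M.qmax) ^ n) * π (Φ ⁻¹' B ∩ U))) := by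
          rw [Measure.smul_apply, Measure.map_apply hΦ hB, Measure.restrict_apply (hΦ hB),
            ENNReal.ofReal_mul (by positivity), ENNReal.ofReal_mul (by positivity),
            ENNReal.ofReal_mul (by positivity), ENNReal.ofReal_toReal hπtop, smul_eq_mul,
            mul_assoc _ (π U), ← mul_assoc (π U), ENNReal.mul_inv_cancel hπ0 hπtop, one_mul]
          ring
      _ ≤ ENNReal.ofReal ρ * (ENNReal.ofReal κ * μ (Φ ⁻¹' B ∩ U)) := by gcongr
      _ = ENNReal.ofReal ρ * ∫⁻ _ in Φ ⁻¹' B ∩ U, ENNReal.ofReal κ ∂μ := by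
          rw [setLIntegral_const]
      _ ≤ ENNReal.ofReal ρ * ∫⁻ v, M.resample lam X (jumps X ∪ points ⟨n, v⟩) B ∂μ := by
          refine mul_le_mul_right ?_ _
          exact (setLIntegral_mono' hA hres).trans (setLIntegral_le_lintegral _ _)
      _ ≤ ENNReal.ofReal (Real.exp (-(M.virtualIntensity lam X univ).toReal) / n.factorial) *
            ∫⁻ v, M.resample lam X (jumps X ∪ points ⟨n, v⟩) B ∂μ := by
          refine mul_le_mul_left (ENNReal.ofReal_le_ofReal ?_) _
          refine div_le_div_of_nonneg_right (Real.exp_le_exp.2 (neg_le_neg ?_)) (by positivity)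
          exact M.virtualIntensity_univ_le hlam X
      _ ≤ ∫⁻ v, M.resample lam X (jumps X ∪ points v) B
            ∂(poissonProcess (M.virtualIntensity lam X)) :=
          mul_lintegral_pi_le_lintegral_poisson _ n ((Measure.measurable_coe hB).comp hm)
      _ = M.kernel lam X B := (Measure.bind_apply hB hm.aemeasurable).symm
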